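/- Let $p$ be a prime, let $k$ be a field of characteristic $p$, let $n\ge 0$, and let $R$ be either the polynomial ring $k[x_1,\dots,x_n]$, in which case assume $[k:k^p]<\infty$, or the formal power series ring $k[[x_1,\dots,x_n]]$, in which case $k$ is arbitrary. For an ideal $I$ of $R$ and an integer $e\ge 1$ let $I^{[p^e]}$ be the ideal generated by the $p^e$-th powers of the elements of $I$. For an ideal $J$ of $R$ let $I_e(J)$ be the smallest ideal $I$ of $R$ with $J\subseteq I^{[p^e]}$, that is, the intersection of all such ideals. For a real number $t$ let the generalized test ideal be $$\tau(J^t)=\bigcup_{e\ge 1} I_e\bigl(J^{\lceil tp^e\rceil}\bigr),$$ where for $t<0$ the exponent $\lceil tp^e\rceil$ is read as $0$ (so that $\tau(J^t)=R$). Then for every $f\in R$ and every real $\varepsilon>0$, $$\mathrm{Jac}(f)=\Bigl(f,\frac{\partial f}{\partial x_1},\dots,\frac{\partial f}{\partial x_n}\Bigr)\subseteq\tau\bigl((f)^{1-\varepsilon}\bigr).$$ -/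

import Mathlib

/-- The Frobenius power `I^[q]`, the ideal generated by the `q`-th powers of the elements of `I`
(used for `q = p ^ e` in characteristic `p`). -/
def frobeniusPower {R : Type*} [CommRing R] (I : Ideal R) (q : ℕ) : Ideal R :=
  Ideal.span ((fun x : R => x ^ q) '' (I : Set R))

/-- The ideal `I_e(J)`: the smallest ideal `I` with `J ≤ I^[p ^ e]`, given as the intersection of
all such ideals. -/
def frobeniusRoot {R : Type*} [CommRing R] (p e : ℕ) (J : Ideal R) : Ideal R :=
  sInf {I : Ideal R | J ≤ frobeniusPower I (p ^ e)}

/-- The intersection is the smallest ideal whenever the latter exists. -/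
theorem frobeniusRoot_eq_of_isLeast {R : Type*} [CommRing R] {p e : ℕ} {J K : Ideal R}
    (hK : IsLeast {I : Ideal R | J ≤ frobeniusPower I (p ^ e)} K) :
    frobeniusRoot p e J = K :=
  hK.isGLB.sInf_eq

/-- The generalized test ideal `τ(J^t)`, literally the union over all positive integers `e` of the
ideals `I_e(J ^ ⌈t p ^ e⌉)`, as a subset of `R`. For `t ≤ 0` the exponent is `0`. -/
def genTestIdeal {R : Type*} [CommRing R] (p : ℕ) (J : Ideal R) (t : ℝ) : Set R :=
  ⋃ e : {e : ℕ // 0 < e}, (frobeniusRoot p e.1 (J ^ ⌈t * (p : ℝ) ^ e.1⌉₊) : Set R)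

/-- The ideal `(f, ∂f/∂x_1, …, ∂f/∂x_n)` of the polynomial ring. -/
noncomputable def polyJacobianIdeal {k : Type*} [Field k] {n : ℕ} (f : MvPolynomial (Fin n) k) :
    Ideal (MvPolynomial (Fin n) k) :=
  Ideal.span (insert f (Set.range fun i : Fin n => MvPolynomial.pderiv i f))

/-- The ideal `(f, ∂f/∂x_1, …, ∂f/∂x_n)` of the power series ring. -/
noncomputable def powerSeriesJacobianIdeal {k : Type*} [Field k] {n : ℕ}
    (f : MvPowerSeries (Fin n) k) : Ideal (MvPowerSeries (Fin n) k) :=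
  Ideal.span (insert f (Set.range fun i : Fin n => MvPowerSeries.pderiv k i f))

/-! The mechanism is that a Cartier operator fixes logarithmic derivatives. Reading off the
coefficients at exponents `p • γ + (p - 1) e_i`, followed by a splitting of Frobenius on `k`, gives
a `p⁻¹`-linear `φ` that kills `∂_i`-images and satisfies `φ (f ^ (p - 1) * ∂_i f) = ∂_i f`
(`contract_pow_sub_one_mul_pderiv`). Iterating, `φ^[e] (f ^ (p ^ e - 1) * ∂_i f) = ∂_i f`. Since
`φ^[e]` maps `I^[p ^ e]` into `I`, any `I` with `f ^ (p ^ e - 1) ∈ I^[p ^ e]` contains `∂_i f`; a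
Frobenius splitting of the ring shows that it contains `f`. For large `e`, `⌈(1 - ε) p ^ e⌉ ≤ p ^ e
- 1`, which suffices. -/

section FrobeniusSemilinear

variable {R : Type*} [CommRing R] {p : ℕ}

/-- An operator with `φ (a ^ p * b) = a * φ b` iterates to one for the exponent `p ^ e`. -/
theorem iterate_pow_mul {φ : R →+ R} (hφ : ∀ a b, φ (a ^ p * b) = a * φ b) (e : ℕ) (a b : R) :
    φ^[e] (a ^ p ^ e * b) = a * φ^[e] b := by
  induction e generalizing b with
  | zero => simp
  | succ e ih => rw [Function.iterate_succ_apply, pow_succ, pow_mul, hφ, ih,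
      Function.iterate_succ_apply]

theorem iterate_mem_of_mem_frobeniusPower {φ : R →+ R} (hφ : ∀ a b, φ (a ^ p * b) = a * φ b)
    (e : ℕ) {I : Ideal R} {x : R} (hx : x ∈ frobeniusPower I (p ^ e)) : φ^[e] x ∈ I := by
  induction hx using Submodule.span_induction with
  | mem x hx =>
    obtain ⟨y, hy, rfl⟩ := hx
    have := iterate_pow_mul hφ e y 1
    rw [mul_one] at this
    simpa only [this] using I.mul_mem_right _ hy
  | zero => rw [iterate_map_zero]; exact I.zero_mem
  | add x y _ _ hx hy => rw [iterate_map_add]; exact I.add_mem hx hy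
  | smul a x hx' _ =>
    -- `φ` is not `R`-linear, so knowing `φ^[e] x ∈ I` says nothing about `a • x`; a second
    -- induction treats all multiples at once.
    clear * - hx' hφ
    induction hx' using Submodule.span_induction generalizing a with
    | mem x hx =>
      obtain ⟨y, hy, rfl⟩ := hx
      rw [smul_eq_mul, mul_comm, iterate_pow_mul hφ]
      exact I.mul_mem_right _ hy
    | zero => rw [smul_zero, iterate_map_zero]; exact I.zero_mem
    | add x y _ _ hx hy => rw [smul_add, iterate_map_add]; exact I.add_mem (hx a) (hy a)
    | smul b x _ hx => rw [smul_smul]; exact hx _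

/-- A Frobenius splitting gives `u ^ (p ^ e) ∈ I^[p ^ e] → u ∈ I`. -/
theorem mem_of_pow_mem_frobeniusPower {φ : R →+ R} (hφ : ∀ a b, φ (a ^ p * b) = a * φ b)
    (hφ1 : φ 1 = 1) (e : ℕ) {I : Ideal R} {u : R} (hu : u ^ p ^ e ∈ frobeniusPower I (p ^ e)) :
    u ∈ I := by
  have h := iterate_mem_of_mem_frobeniusPower hφ e hu
  have h1 := iterate_pow_mul hφ e u 1
  rw [mul_one, Function.iterate_fixed hφ1, mul_one] at h1
  rwa [h1] at h

theorem iterate_pow_sub_one_mul [NeZero p] {φ : R →+ R} (hφ : ∀ a b, φ (a ^ p * b) = a * φ b)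
    {f g : R} (h : φ (f ^ (p - 1) * g) = g) (e : ℕ) : φ^[e] (f ^ (p ^ e - 1) * g) = g := by
  induction e with
  | zero => simp
  | succ e ih =>
    have hp : 1 ≤ p := NeZero.one_le
    have hpe : 1 ≤ p ^ e := Nat.one_le_pow _ _ hp
    have hexp : p ^ (e + 1) - 1 = (p ^ e - 1) * p + (p - 1) := by
      zify [hp, hpe, Nat.one_le_pow (e + 1) _ hp]
      ring
    rw [Function.iterate_succ_apply, hexp, pow_add, pow_mul, mul_assoc, hφ, h, ih]

end FrobeniusSemilinear

/-! ### Logarithmic derivatives fixed by a `p⁻¹`-linear operator -/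

section LogarithmicDerivative

variable {A R : Type*} [CommRing A] [CommRing R] [Algebra A R] {p : ℕ}

/-- The chain rule for a derivation and an integral polynomial expression in several elements. -/
theorem Derivation.apply_mvPolynomial_aeval {σ : Type*} [Fintype σ] (D : Derivation A R R)
    (v : σ → R) (P : MvPolynomial σ ℤ) :
    D (MvPolynomial.aeval v P) =
      ∑ i, MvPolynomial.aeval v (MvPolynomial.pderiv i P) * D (v i) := by
  classical
  induction P using MvPolynomial.induction_on with
  | C a => simp
  | add P Q hP hQ => simp [hP, hQ, add_mul, Finset.sum_add_distrib]
  | mul_X P i hP =>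
    simp only [map_mul, MvPolynomial.aeval_X, Derivation.leibniz, smul_eq_mul, hP, map_add,
      MvPolynomial.pderiv_X, add_mul, Finset.sum_add_distrib, Finset.mul_sum]
    congr 1
    · rw [Finset.sum_eq_single i (by simp +contextual) (by simp)]
      simp
    · exact Finset.sum_congr rfl fun j _ => by ring

/-- The form `(f + g) ^ (p - 1) d(f + g) - f ^ (p - 1) df - g ^ (p - 1) dg` is exact. -/
theorem Derivation.exists_add_pow_sub_one_mul (hp : p.Prime) (D : Derivation A R R) (f g : R) :
    ∃ h, (f + g) ^ (p - 1) * D (f + g) = f ^ (p - 1) * D f + g ^ (p - 1) * D g + D h := by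
  -- The primitive is `((X + Y) ^ p - X ^ p - Y ^ p) / p`. It is differentiated over `ℤ`, where `p`
  -- can be cancelled, and then specialised to `R`.
  obtain ⟨r, hr⟩ := exists_add_pow_prime_eq hp (MvPolynomial.X 0 : MvPolynomial (Fin 2) ℤ)
    (MvPolynomial.X 1)
  set H := MvPolynomial.X 0 * MvPolynomial.X 1 * r with hH
  have hp0 : (p : MvPolynomial (Fin 2) ℤ) ≠ 0 := by exact_mod_cast hp.ne_zero
  have hr' : (p : MvPolynomial (Fin 2) ℤ) * H = (MvPolynomial.X 0 + MvPolynomial.X 1) ^ p -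
      MvPolynomial.X 0 ^ p - MvPolynomial.X 1 ^ p := by
    rw [hr, hH]; ring
  have key : ∀ i : Fin 2, MvPolynomial.pderiv i H =
      (MvPolynomial.X 0 + MvPolynomial.X 1) ^ (p - 1) - MvPolynomial.X i ^ (p - 1) := by
    rw [Fin.forall_fin_two]
    constructor
    · have := congrArg (MvPolynomial.pderiv 0) hr'
      simp [Derivation.leibniz_pow, MvPolynomial.pderiv_X] at this
      exact mul_left_cancel₀ hp0 (by linear_combination this)
    · have := congrArg (MvPolynomial.pderiv 1) hr'
      simp [Derivation.leibniz_pow, MvPolynomial.pderiv_X] at this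
      exact mul_left_cancel₀ hp0 (by linear_combination this)
  refine ⟨MvPolynomial.aeval ![f, g] H, ?_⟩
  rw [D.apply_mvPolynomial_aeval, Fin.sum_univ_two, key, key]
  simp
  ring

/-- If `φ` is `p⁻¹`-linear and kills the image of the derivation `D`, then the `f` with
`φ (f ^ (p - 1) * D f) = D f` form a subsemiring. -/
def logDerivativeFixed (hp : p.Prime) (D : Derivation A R R) (φ : R →+ R)
    (hφ : ∀ a b, φ (a ^ p * b) = a * φ b) (hD : ∀ h, φ (D h) = 0) : Subsemiring R where
  carrier := {f | φ (f ^ (p - 1) * D f) = D f}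
  zero_mem' := by simp
  one_mem' := by simp
  add_mem' {f g} hf hg := by
    obtain ⟨h, hh⟩ := D.exists_add_pow_sub_one_mul hp f g
    simp only [Set.mem_ofPred_eq] at *
    rw [hh, map_add, map_add, hf, hg, hD, add_zero, map_add]
  mul_mem' {f g} hf hg := by
    simp only [Set.mem_ofPred_eq] at *
    have h : (f * g) ^ (p - 1) * D (f * g) =
        f ^ p * (g ^ (p - 1) * D g) + g ^ p * (f ^ (p - 1) * D f) := by
      obtain ⟨m, rfl⟩ := Nat.exists_eq_succ_of_ne_zero hp.ne_zero
      simp only [Nat.succ_eq_add_one, Nat.add_sub_cancel, D.leibniz, smul_eq_mul]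
      ring
    rw [h, map_add, hφ, hφ, hf, hg, D.leibniz, smul_eq_mul, smul_eq_mul]

theorem mem_logDerivativeFixed {hp : p.Prime} {D : Derivation A R R} {φ : R →+ R}
    {hφ : ∀ a b, φ (a ^ p * b) = a * φ b} {hD : ∀ h, φ (D h) = 0} {f : R} :
    f ∈ logDerivativeFixed hp D φ hφ hD ↔ φ (f ^ (p - 1) * D f) = D f := Iff.rfl

end LogarithmicDerivative

/-- The Frobenius of a field has a `p⁻¹`-linear left inverse. -/
theorem exists_frobenius_splitting (p : ℕ) [Fact p.Prime] (k : Type*) [Field k] [CharP k p] :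
    ∃ l : k →+ k, (∀ a b, l (a ^ p * b) = a * l b) ∧ l 1 = 1 := by
  let F := frobenius k p
  -- `g` is a `k^p`-linear retraction of `k` onto `k^p`; `l` is `g` followed by the `p`-th root.
  obtain ⟨g, hg⟩ := (Algebra.linearMap F.fieldRange k).exists_leftInverse_of_injective
    (LinearMap.ker_eq_bot.2 Subtype.val_injective)
  choose l hl using fun b => (g b).2
  have hF (x y : k) (h : F x = F y) : x = y := F.injective h
  refine ⟨⟨⟨l, hF _ _ ?_⟩, fun x y => hF _ _ ?_⟩, fun a b => hF _ _ ?_, hF _ _ ?_⟩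
  · rw [hl, map_zero, map_zero]; rfl
  · rw [hl, map_add, map_add, hl, hl]; rfl
  · have := g.map_smul ⟨F a, a, rfl⟩ b
    change F (l (a ^ p * b)) = F (a * l b)
    rw [map_mul, hl, hl]
    exact congrArg Subtype.val this
  · have := LinearMap.congr_fun hg 1
    change F (l 1) = F 1
    rw [hl, map_one F]
    simpa using congrArg Subtype.val this

/-! ### Cartier operators on power series and polynomials -/

section Contraction

variable {σ k : Type*} [Field k] {p : ℕ}

/-- The operator on power series which reads off the coefficients at the exponents `p • γ + s` and
applies `l` to them. -/
noncomputable def MvPowerSeries.contract (p : ℕ) (l : k →+ k) (s : σ →₀ ℕ) :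
    MvPowerSeries σ k →+ MvPowerSeries σ k where
  toFun g := fun γ => l (MvPowerSeries.coeff (p • γ + s) g)
  map_zero' := funext fun _ => by rw [map_zero, map_zero]; rfl
  map_add' f g := funext fun _ => by rw [map_add, map_add]; rfl

theorem MvPowerSeries.coeff_contract (l : k →+ k) (s γ : σ →₀ ℕ) (g : MvPowerSeries σ k) :
    coeff γ (contract p l s g) = l (coeff (p • γ + s) g) := rfl

theorem MvPowerSeries.coeff_smul_pow [Fact p.Prime] [CharP k p] (a : MvPowerSeries σ k)
    (γ : σ →₀ ℕ) : coeff (p • γ) (a ^ p) = coeff γ a ^ p := by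
  have hp : p ≠ 0 := (Fact.out : p.Prime).ne_zero
  rw [← map_frobenius_expand p hp, coeff_map, coeff_expand_smul, frobenius_def]

theorem MvPowerSeries.coeff_pow_of_not_dvd [Fact p.Prime] [CharP k p] (a : MvPowerSeries σ k)
    {γ : σ →₀ ℕ} {i : σ} (h : ¬ p ∣ γ i) : coeff γ (a ^ p) = 0 := by
  have hp : p ≠ 0 := (Fact.out : p.Prime).ne_zero
  rw [← map_frobenius_expand p hp, coeff_map, coeff_expand_of_not_dvd p hp _ h, map_zero]

/-- Only exponents `p • δ` occur in `a ^ p`, and `s i < p` makes `p • δ ≤ p • γ + s` equivalent to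
`δ ≤ γ`, so the two convolution sums match. -/
theorem MvPowerSeries.contract_pow_mul [Fact p.Prime] [CharP k p] {l : k →+ k}
    (hl : ∀ a b, l (a ^ p * b) = a * l b) {s : σ →₀ ℕ} (hs : ∀ i, s i < p)
    (a b : MvPowerSeries σ k) : contract p l s (a ^ p * b) = a * contract p l s b := by
  classical
  have hp : p ≠ 0 := (Fact.out : p.Prime).ne_zero
  ext γ
  rw [coeff_contract, coeff_mul, coeff_mul, map_sum]
  symm
  refine Finset.sum_of_injOn (fun x => (p • x.1, p • x.2 + s)) ?_ ?_ ?_ ?_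
  · rintro ⟨x, y⟩ _ ⟨x', y'⟩ _ h
    simpa [nsmul_right_inj hp] using h
  · rintro ⟨x, y⟩ h
    simp only [Finset.mem_coe, Finset.HasAntidiagonal.mem_antidiagonal] at h ⊢
    rw [← h, smul_add, add_assoc]
  · rintro ⟨u, v⟩ h hn
    rw [Finset.HasAntidiagonal.mem_antidiagonal] at h
    by_cases hu : ∀ i, p ∣ u i
    · refine absurd ?_ hn
      have h' (i : σ) : u i + v i = p * γ i + s i := by
        simpa using DFunLike.congr_fun h i
      refine ⟨(u.mapRange (· / p) (by simp), γ - u.mapRange (· / p) (by simp)), ?_, ?_⟩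
      · have hle : u.mapRange (· / p) (by simp) ≤ γ := fun i => by
          obtain ⟨c, hc⟩ := hu i
          have := h' i
          have := hs i
          simp only [Finsupp.mapRange_apply, hc, Nat.mul_div_cancel_left _ (Nat.pos_of_ne_zero hp)]
          by_contra! hlt
          nlinarith
        simp [add_tsub_cancel_of_le hle]
      · ext i
        · simp [Nat.mul_div_cancel' (hu i)]
        · have := h' i
          obtain ⟨c, hc⟩ := hu i
          have := hs i
          have hcle : c ≤ γ i := by
            by_contra! hlt
            nlinarith
          simp only [Finsupp.coe_add, Finsupp.coe_smul, Finsupp.coe_tsub, Pi.add_apply,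
            Pi.smul_apply, Pi.sub_apply, Finsupp.mapRange_apply, hc, smul_eq_mul,
            Nat.mul_div_cancel_left _ (Nat.pos_of_ne_zero hp), Nat.mul_sub]
          have := Nat.mul_le_mul_left p hcle
          omega
    · push Not at hu
      obtain ⟨i, hi⟩ := hu
      rw [coeff_pow_of_not_dvd a hi, zero_mul, map_zero]
  · rintro ⟨x, y⟩ _
    rw [coeff_contract, coeff_smul_pow, hl]

theorem MvPowerSeries.contract_zero_one {l : k →+ k} (hp : p ≠ 0) (hl : l 1 = 1) :
    contract p l (0 : σ →₀ ℕ) 1 = 1 := by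
  classical
  ext γ
  rw [coeff_contract, coeff_one, coeff_one]
  by_cases h : γ = 0 <;> simp [h, hp, hl]

theorem MvPowerSeries.contract_single_X_pow {l : k →+ k} (hp : p ≠ 0) (hl : l 1 = 1) (i : σ) :
    contract p l (Finsupp.single i (p - 1)) (X i ^ (p - 1)) = 1 := by
  classical
  ext γ
  rw [coeff_contract, coeff_X_pow, coeff_one]
  by_cases h : γ = 0 <;> simp [h, hp, hl]

/-- Each coefficient read off carries the factor `p * (γ i + 1)` produced by differentiation. -/
theorem MvPowerSeries.contract_single_pderiv [NeZero p] [CharP k p] (l : k →+ k) (i : σ)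
    (h : MvPowerSeries σ k) :
    contract p l (Finsupp.single i (p - 1)) (pderiv k i h) = 0 := by
  ext γ
  have hc : ((p * γ i + (p - 1) : ℕ) : k) + 1 = 0 := by
    have : p * γ i + (p - 1) + 1 = p * (γ i + 1) := by
      have : 1 ≤ p := NeZero.one_le
      rw [add_assoc, Nat.sub_add_cancel this, mul_add, mul_one]
    rw [← Nat.cast_succ, Nat.succ_eq_add_one, this, Nat.cast_mul, CharP.cast_eq_zero, zero_mul]
  rw [coeff_contract, coeff_pderiv]
  simp only [Finsupp.coe_add, Finsupp.coe_smul, Pi.add_apply, Pi.smul_apply, smul_eq_mul,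
    Finsupp.single_eq_same, hc, mul_zero, map_zero]

/-- The coefficient of `X i ^ j` in `f`, as a series in `X i ^ p` and the other variables. -/
noncomputable def MvPowerSeries.residueComponent (p : ℕ) (i : σ) (j : ℕ) (f : MvPowerSeries σ k) :
    MvPowerSeries σ k :=
  fun γ => if p ∣ γ i then coeff (γ + Finsupp.single i j) f else 0

theorem MvPowerSeries.coeff_residueComponent (i : σ) (j : ℕ) (f : MvPowerSeries σ k)
    (γ : σ →₀ ℕ) : coeff γ (residueComponent p i j f) =
      if p ∣ γ i then coeff (γ + Finsupp.single i j) f else 0 := rfl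

theorem MvPowerSeries.pderiv_residueComponent [CharP k p] (i : σ) (j : ℕ)
    (f : MvPowerSeries σ k) : pderiv k i (residueComponent p i j f) = 0 := by
  ext γ
  rw [coeff_pderiv, coeff_residueComponent]
  split_ifs with h
  · have h0 : ((γ i : k) + 1) = 0 := by
      rw [← Nat.cast_succ, CharP.cast_eq_zero_iff k p]
      simpa using h
    simp [h0]
  · simp

theorem MvPowerSeries.sum_residueComponent_mul_X_pow [NeZero p] (i : σ) (f : MvPowerSeries σ k) :
    ∑ j ∈ Finset.range p, residueComponent p i j f * X i ^ j = f := by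
  classical
  ext γ
  have hlt : γ i % p < p := Nat.mod_lt _ (NeZero.pos p)
  have hle : γ i % p ≤ γ i := Nat.mod_le _ _
  rw [map_sum, Finset.sum_eq_single_of_mem (γ i % p) (Finset.mem_range.2 hlt)]
  · rw [X_pow_eq, coeff_mul_monomial, if_pos (by simpa using hle), coeff_residueComponent,
      if_pos (by simpa using Nat.dvd_sub_mod (γ i)), mul_one,
      tsub_add_cancel_of_le (by simpa using hle)]
  · intro j hj hne
    rw [X_pow_eq, coeff_mul_monomial]
    split_ifs with h
    · rw [coeff_residueComponent, if_neg, zero_mul]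
      have hji : j ≤ γ i := by simpa using h
      intro hd
      apply hne
      have hd : p ∣ γ i - j := by simpa using hd
      rw [← (Nat.modEq_iff_dvd' hji).2 hd, Nat.mod_eq_of_lt (Finset.mem_range.1 hj)]
    · rfl

/-- The fixed elements form a subsemiring containing `X i` and all series killed by `∂_i`; `f` is a
polynomial in `X i` with such coefficients. -/
theorem MvPowerSeries.contract_pow_sub_one_mul_pderiv [hp : Fact p.Prime] [CharP k p] {l : k →+ k}
    (hl : ∀ a b, l (a ^ p * b) = a * l b) (hl1 : l 1 = 1) (i : σ) (f : MvPowerSeries σ k) :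
    contract p l (Finsupp.single i (p - 1)) (f ^ (p - 1) * pderiv k i f) = pderiv k i f := by
  classical
  have hs (j : σ) : Finsupp.single i (p - 1) j < p := by
    have := hp.out.pos
    rw [Finsupp.single_apply]
    split_ifs <;> omega
  rw [← mem_logDerivativeFixed (hp := hp.out) (hφ := contract_pow_mul hl hs)
    (hD := contract_single_pderiv l i), ← sum_residueComponent_mul_X_pow (p := p) i f]
  refine sum_mem fun j _ => mul_mem ?_ (pow_mem ?_ j)
  · rw [mem_logDerivativeFixed, pderiv_residueComponent, mul_zero, map_zero]
  · rw [mem_logDerivativeFixed, pderiv_X_self, mul_one, contract_single_X_pow hp.out.ne_zero hl1]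

/-- The polynomial version of `MvPowerSeries.contract`. -/
noncomputable def MvPolynomial.contract (p : ℕ) [NeZero p] (l : k →+ k) (s : σ →₀ ℕ) :
    MvPolynomial σ k →+ MvPolynomial σ k where
  toFun g := AddMonoidAlgebra.ofCoeff <| Finsupp.mapRange l (map_zero l) <|
    Finsupp.comapDomain (fun γ => p • γ + s) (AddMonoidAlgebra.coeff g)
      ((add_left_injective s).comp (nsmul_right_injective (NeZero.ne p))).injOn
  map_zero' := MvPolynomial.ext _ _ fun _ => map_zero l
  map_add' _ _ := MvPolynomial.ext _ _ fun _ => map_add l _ _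

theorem MvPolynomial.coe_contract [NeZero p] (l : k →+ k) (s : σ →₀ ℕ) (g : MvPolynomial σ k) :
    (contract p l s g : MvPowerSeries σ k) = MvPowerSeries.contract p l s g :=
  MvPowerSeries.ext fun _ => rfl

end Contraction

/-! ### Passage to the test ideal -/

/-- If every ideal `I` with `f ^ (p ^ e - 1) ∈ I^[p ^ e]` contains `s`, then the ideal generated by
`s` lies in `τ(f ^ (1 - ε))`. -/
theorem span_subset_genTestIdeal {R : Type*} [CommRing R] {p : ℕ} [hp : Fact p.Prime] {f : R}
    {s : Set R} (hs : ∀ (e : ℕ) (I : Ideal R), f ^ (p ^ e - 1) ∈ frobeniusPower I (p ^ e) →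
      ∀ u ∈ s, u ∈ I) {ε : ℝ} (hε : 0 < ε) :
    (Ideal.span s : Set R) ⊆ genTestIdeal p (Ideal.span {f}) (1 - ε) := by
  have hp1 : (1 : ℝ) < p := by exact_mod_cast hp.out.one_lt
  -- The level used is `e + 1`, since the union runs over positive exponents only.
  obtain ⟨e, he⟩ := pow_unbounded_of_one_lt ε⁻¹ hp1
  have hlt : ε⁻¹ < (p : ℝ) ^ (e + 1) :=
    he.trans_le (pow_le_pow_right₀ hp1.le e.le_succ)
  have hone : 1 ≤ ε * (p : ℝ) ^ (e + 1) := by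
    rw [← mul_inv_cancel₀ hε.ne']
    exact mul_le_mul_of_nonneg_left hlt.le hε.le
  have hceil : ⌈(1 - ε) * (p : ℝ) ^ (e + 1)⌉₊ ≤ p ^ (e + 1) - 1 := by
    rw [Nat.ceil_le, Nat.cast_sub (Nat.one_le_pow _ _ hp.out.pos)]
    push_cast
    linarith
  refine Set.subset_iUnion_of_subset ⟨e + 1, e.succ_pos⟩ ?_
  refine SetLike.coe_subset_coe.2 (le_sInf fun I hI => Ideal.span_le.2 fun u hu => ?_)
  refine hs (e + 1) I ?_ u hu
  refine Ideal.mem_of_dvd _ (pow_dvd_pow f hceil) (hI ?_)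
  exact Ideal.pow_mem_pow (Ideal.mem_span_singleton_self f) _

/-- The common form of the inclusion of the Jacobian ideal in the test ideal: it holds for partial
derivatives `d i` in a ring with a Frobenius splitting and `p⁻¹`-linear operators `φ i` for which
`φ i (f ^ (p - 1) * d i f) = d i f`. -/
theorem span_insert_range_subset_genTestIdeal {R ι : Type*} [CommRing R] {p : ℕ}
    [hp : Fact p.Prime] {φ₀ : R →+ R} {φ : ι → R →+ R} (h₀ : ∀ a b, φ₀ (a ^ p * b) = a * φ₀ b)
    (h₁ : φ₀ 1 = 1) (hφ : ∀ i a b, φ i (a ^ p * b) = a * φ i b) {f : R} {d : ι → R}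
    (hd : ∀ i, φ i (f ^ (p - 1) * d i) = d i) {ε : ℝ} (hε : 0 < ε) :
    (Ideal.span (insert f (Set.range d)) : Set R) ⊆
      genTestIdeal p (Ideal.span {f}) (1 - ε) := by
  refine span_subset_genTestIdeal (fun e I hI u hu => ?_) hε
  rcases hu with rfl | ⟨i, rfl⟩
  · refine mem_of_pow_mem_frobeniusPower h₀ h₁ e ?_
    rw [← pow_sub_one_mul (pow_ne_zero e hp.out.ne_zero)]
    exact Ideal.mul_mem_right _ _ hI
  · have h := iterate_mem_of_mem_frobeniusPower (hφ i) e (Ideal.mul_mem_right (d i) _ hI)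
    rwa [iterate_pow_sub_one_mul (hφ i) (hd i)] at h

theorem mainTheorem1 (p : ℕ) [Fact p.Prime] (k : Type*) [Field k] [CharP k p] (n : ℕ) :
    (Module.Finite (frobenius k p).fieldRange k →
      ∀ (f : MvPolynomial (Fin n) k) (ε : ℝ), 0 < ε →
        (polyJacobianIdeal f : Set (MvPolynomial (Fin n) k)) ⊆
          genTestIdeal p (Ideal.span {f}) (1 - ε)) ∧
    (∀ (f : MvPowerSeries (Fin n) k) (ε : ℝ), 0 < ε →
      (powerSeriesJacobianIdeal f : Set (MvPowerSeries (Fin n) k)) ⊆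
        genTestIdeal p (Ideal.span {f}) (1 - ε)) := by
  have hp : p.Prime := Fact.out
  obtain ⟨l, hl, hl1⟩ := exists_frobenius_splitting p k
  have hs₀ (j : Fin n) : (0 : Fin n →₀ ℕ) j < p := hp.pos
  have hs (i j : Fin n) : Finsupp.single i (p - 1) j < p := by
    have := hp.pos
    rw [Finsupp.single_apply]
    split_ifs <;> omega
  constructor
  · intro _ f ε hε
    have hmul {s : Fin n →₀ ℕ} (hs : ∀ j, s j < p) (a b : MvPolynomial (Fin n) k) :
        MvPolynomial.contract p l s (a ^ p * b) = a * MvPolynomial.contract p l s b := by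
      -- The embedding into power series commutes with contraction and `∂_i`, so the polynomial
      -- identities are inherited.
      apply MvPolynomial.coe_injective (Fin n) k
      rw [MvPolynomial.coe_contract, MvPolynomial.coe_mul, MvPolynomial.coe_mul,
        MvPolynomial.coe_pow, MvPowerSeries.contract_pow_mul hl hs, MvPolynomial.coe_contract]
    refine span_insert_range_subset_genTestIdeal (hmul hs₀) ?_ (fun i => hmul (hs i))
      (fun i => ?_) hε
    · apply MvPolynomial.coe_injective (Fin n) k
      rw [MvPolynomial.coe_contract, MvPolynomial.coe_one,
        MvPowerSeries.contract_zero_one hp.ne_zero hl1]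
    · apply MvPolynomial.coe_injective (Fin n) k
      rw [MvPolynomial.coe_contract, MvPolynomial.coe_mul, MvPolynomial.coe_pow,
        ← MvPowerSeries.pderiv_coe, MvPowerSeries.contract_pow_sub_one_mul_pderiv hl hl1]
  · intro f ε hε
    exact span_insert_range_subset_genTestIdeal (MvPowerSeries.contract_pow_mul hl hs₀)
      (MvPowerSeries.contract_zero_one hp.ne_zero hl1)
      (fun i => MvPowerSeries.contract_pow_mul hl (hs i))
      (fun i => MvPowerSeries.contract_pow_sub_one_mul_pderiv hl hl1 i f) hε
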